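/- Notation. For a prime $p$, an integer $n$ and $k\in\mathbb{N}$, let $\nu_p(n)$ be the $p$-adic valuation of $n$ (with $\nu_p(0)=\infty$) and $\nu_p^{(k)}(n):=\min\{\nu_p(n),k\}$. For a positive integer $n$, let $n_{p'}:=n/p^{\nu_p(n)}$. For an integer $a$ coprime to $p$, $\operatorname{ord}(a)$ is the multiplicative order of $a$ modulo $p^k$; for an integer $b$, $\operatorname{aord}(b)$ is the additive order of $b$ in $\mathbb{Z}/p^k\mathbb{Z}$. The cycle type of a permutation $g$ of a set of size $n$ is the monomial $\operatorname{CT}(g)=x_1^{k_1}\cdots x_n^{k_n}\in\mathbb{Q}[x_1,x_2,\ldots]$, where $k_i$ is the number of cycles of length $i$ of $g$ (fixed points are cycles of length $1$). Let $p$ be a prime, $k\geq1$ an integer, and $a,b$ integers with $p\nmid a$. Let $A$ be the permutation $x\mapsto ax+b$ of $\mathbb{Z}/p^k\mathbb{Z}$. (1) Assume $p>2$. (a) If $a\not\equiv1\pmod p$, then, with $o:=\operatorname{ord}(a)_{p'}$ and $v:=\nu_p(\operatorname{ord}(a))$, \[\operatorname{CT}(A)=x_1\cdot x_o^{(p^{k-v}-1)/o}\cdot\prod_{s=1}^{v}x_{o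 p^s}^{p^{k-1-v}(p-1)/o}.\] (b) If $a\equiv1\pmod p$ and $\nu_p^{(k)}(b)\geq w:=\nu_p^{(k)}(a-1)$, then \[\operatorname{CT}(A)=x_1^{p^{w}}\cdot\prod_{s=1}^{k-w}x_{p^s}^{p^{w-1}(p-1)}.\] (c) If $a\equiv1\pmod p$ and $\nu_p^{(k)}(b)<\nu_p^{(k)}(a-1)$, then \[\operatorname{CT}(A)=x_{\operatorname{aord}(b)}^{p^k/\operatorname{aord}(b)}.\] (2) Assume $p=2$. (a) If $k=1$, then $\operatorname{CT}(A)=x_{\operatorname{aord}(b)}^{2/\operatorname{aord}(b)}$. (b) If $k=2$, then $a\equiv1$ or $a\equiv3\pmod 4$. If $a\equiv1\pmod 4$, then $\operatorname{CT}(A)=x_{\operatorname{aord}(b)}^{4/\operatorname{aord}(b)}$. If $a\equiv3\pmod 4$, then $\operatorname{CT}(A)=x_1^2x_2$ when $2\mid b$, and $\operatorname{CT}(A)=x_2^2$ when $2\nmid b$. (c) If $k\geq3$, then there are unique $\epsilon\in\{0,1\}$ and $e\in\{0,1,\ldots,2^{k-2}-1\}$ with $a\equiv(-1)^{\epsilon}5^e\pmod{2^k}$.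 Put $t:=\nu_2^{(k-2)}(e)$ and $r:=\nu_2^{(k-3)}(e)$. If $\epsilon=1$ and $2\nmid b$, then $\operatorname{CT}(A)=x_{2^{k-1-t}}^{2^{1+t}}$. If $\epsilon=1$ and $2\mid b$, then $\operatorname{CT}(A)=x_1^2\,x_2^{2^{2+r}-1}\prod_{s=2}^{k-2-r}x_{2^s}^{2^{1+r}}$. If $\epsilon=0$ and $\nu_2^{(k)}(b)<\nu_2^{(k)}(a-1)$, then $\operatorname{CT}(A)=x_{\operatorname{aord}(b)}^{2^k/\operatorname{aord}(b)}$. If $\epsilon=0$ and $\nu_2^{(k)}(b)\geq\nu_2^{(k)}(a-1)$, then $\operatorname{CT}(A)=x_1^{2^{2+t}}\prod_{s=1}^{k-2-t}x_{2^s}^{2^{1+t}}$. -/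

import Mathlib

open MvPolynomial

/-- The truncated valuation `min (ν_p n) k` of an integer `n`, where `ν_p 0 = ∞`. -/
noncomputable def truncVal (p k : ℕ) (n : ℤ) : ℕ :=
  (min (emultiplicity (p : ℤ) n) (k : ℕ∞)).toNat

/-- The number of cycles of length `i` of a permutation of a finite set, fixed points being
counted as cycles of length `1`. -/
def cycleCount {α : Type*} [Fintype α] [DecidableEq α] (σ : Equiv.Perm α) (i : ℕ) : ℕ :=
  σ.partition.parts.count i

/-- The cycle type of a permutation of a set of size `n`: the monomial
`x_1 ^ k_1 * ⋯ * x_n ^ k_n`, where `k_i` is the number of cycles of length `i`. -/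
noncomputable def cycleMonomial {α : Type*} [Fintype α] [DecidableEq α] (σ : Equiv.Perm α) :
    MvPolynomial ℕ ℚ :=
  ∏ i ∈ Finset.Icc 1 (Fintype.card α), (X i : MvPolynomial ℕ ℚ) ^ cycleCount σ i

theorem affineMap_bijective (p k : ℕ) [Fact p.Prime] (a b : ℤ) (ha : ¬ (p : ℤ) ∣ a) :
    Function.Bijective (fun x : ZMod (p ^ k) => (a : ZMod (p ^ k)) * x + (b : ZMod (p ^ k))) := by
  have hu : IsUnit (a : ZMod (p ^ k)) := by
    have hc : IsCoprime a ((p ^ k : ℕ) : ℤ) := by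
      push_cast
      refine IsCoprime.pow_right ?_
      exact ((Nat.prime_iff_prime_int.mp Fact.out).coprime_iff_not_dvd.mpr ha).symm
    exact (ZMod.unitOfIsCoprime a hc).isUnit
  rw [← Finite.injective_iff_bijective]
  intro x y h
  exact hu.mul_left_cancel (add_right_cancel h)

/-- The affine permutation `x ↦ a * x + b` of `ℤ / p ^ k ℤ`, for integers `a`, `b` with `p ∤ a`. -/
noncomputable def affinePerm (p k : ℕ) [Fact p.Prime] (a b : ℤ) (ha : ¬ (p : ℤ) ∣ a) :
    Equiv.Perm (ZMod (p ^ k)) :=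
  Equiv.ofBijective (fun x : ZMod (p ^ k) => (a : ZMod (p ^ k)) * x + (b : ZMod (p ^ k)))
    (affineMap_bijective p k a b ha)

/-! The cycle type is found by counting points by minimal period. Since `A^n x = x + S_n * ((a - 1)
* x + b)` with `S_n = 1 + a + ... + a^(n-1)`, the point `x` has period dividing `n` exactly when the
additive order of `(a - 1) * x + b` divides `S_n`.

If `ν(a - 1) ≤ ν(b)` (truncated at `k`), there is a fixed point `y`, and translating it to `0` turns
`A` into multiplication by `a`. The `φ(p^m)` points with `x - y` of additive order `p^m` then have
period `ord(a mod p^m)`. Lifting the exponent gives these orders: if `o` is the order of `a` mod `p`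
(mod `4` when `p = 2`) and `c = ν(a^o - 1)`, the order is `o * p^(m - c)` (with `m - c` read as `0`
for `m < c`) once `m ≥ 1` (`m ≥ 2` when `p = 2`).

If `a ≡ 1` mod `p` (mod `4` when `p = 2`) and `ν(b) < ν(a - 1)`, every `(a - 1) * x + b` has the
valuation of `b`, and `ν(S_n) = ν(n)`, so all periods equal the additive order of `b`. For `p = 2`,
`a ≡ 3` mod `4` and `b` odd, all `(a - 1) * x + b` are units and `a - 1` is twice an odd number, so
all periods equal the order of `a` modulo `2^(k+1)`. -/

/-! ### Cycle counts through minimal periods -/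

theorem Equiv.Perm.card_support_cycleOf_eq_minimalPeriod {α : Type*} [Fintype α] [DecidableEq α]
    (σ : Equiv.Perm α) {x : α} (hx : x ∈ σ.support) :
    (σ.cycleOf x).support.card = Function.minimalPeriod σ x := by
  refine eq_of_forall_dvd fun n => ?_
  rw [← Function.isPeriodicPt_iff_minimalPeriod_dvd, Function.IsPeriodicPt, Function.IsFixedPt,
    Equiv.Perm.iterate_eq_pow, (σ.isCycleOn_support_cycleOf x).pow_apply_eq]
  rw [Equiv.Perm.mem_support_cycleOf_iff]
  exact ⟨Equiv.Perm.SameCycle.refl _ _, hx⟩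

/-- The points of minimal period `i` split into the supports of the `i`-cycles, each of size `i`.
Fixed points are treated apart because `cycleType` omits them. -/
theorem cycleCount_mul_eq_card_minimalPeriod {α : Type*} [Fintype α] [DecidableEq α]
    (σ : Equiv.Perm α) {i : ℕ} (hi : 1 ≤ i) :
    cycleCount σ i * i = (Finset.univ.filter fun x => Function.minimalPeriod σ x = i).card := by
  unfold cycleCount
  rw [Equiv.Perm.parts_partition, Multiset.count_add, Multiset.count_replicate]
  rcases eq_or_lt_of_le hi with rfl | hi
  · have h0 : σ.cycleType.count 1 = 0 :=
      Multiset.count_eq_zero.2 fun h => lt_irrefl _ (Equiv.Perm.one_lt_of_mem_cycleType h)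
    rw [h0, if_pos rfl, zero_add, mul_one, ← Finset.card_compl]
    congr 1
    ext x
    simp [Function.minimalPeriod_eq_one_iff_isFixedPt, Function.IsFixedPt]
  · have key : ∀ x, Function.minimalPeriod σ x = i → x ∈ σ.support := by
      intro x hx
      rw [Equiv.Perm.mem_support]
      intro h
      rw [Function.minimalPeriod_eq_one_iff_isFixedPt.2 h] at hx
      omega
    rw [if_neg hi.ne, add_zero, Equiv.Perm.cycleType_def, Multiset.count_map,
      Finset.card_eq_sum_card_fiberwise (f := σ.cycleOf)
        (t := σ.cycleFactorsFinset.filter fun c => i = c.support.card)]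
    · rw [Finset.sum_const_nat (m := i)]
      · rfl
      intro c hc
      obtain ⟨hcσ, rfl⟩ := Finset.mem_filter.1 hc
      congr 1
      ext x
      simp only [Finset.mem_filter, Finset.mem_univ, true_and]
      constructor
      · rintro ⟨hx, rfl⟩
        rw [Equiv.Perm.mem_support_cycleOf_iff]
        exact ⟨Equiv.Perm.SameCycle.refl _ _, key x hx⟩
      · intro hx
        have h := Equiv.Perm.cycle_is_cycleOf hx hcσ
        have hs := Equiv.Perm.mem_cycleFactorsFinset_support_le hcσ hx
        exact ⟨by rw [← σ.card_support_cycleOf_eq_minimalPeriod hs, ← h], h.symm⟩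
    · intro x hx
      have hx : Function.minimalPeriod σ x = i := by simpa using hx
      have hs := key x hx
      simp only [Finset.coe_filter, Set.mem_ofPred_eq]
      exact ⟨Equiv.Perm.cycleOf_mem_cycleFactorsFinset_iff.2 hs,
        by rw [σ.card_support_cycleOf_eq_minimalPeriod hs, hx]⟩

/-- Points may be sorted by any label `m x` that determines the period. The length `f` need not be
injective on labels: labels of equal length merge by adding exponents. -/
theorem cycleMonomial_eq_prod {α ι : Type*} [Fintype α] [DecidableEq α] [DecidableEq ι]
    (σ : Equiv.Perm α) (J : Finset ι) (m : α → ι) (f c : ι → ℕ) (hm : ∀ x, m x ∈ J)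
    (hJ : ∀ j ∈ J, ∃ x, m x = j) (hf : ∀ x, Function.minimalPeriod σ x = f (m x))
    (hc : ∀ j ∈ J, (Finset.univ.filter fun x => m x = j).card = f j * c j) :
    cycleMonomial σ = ∏ j ∈ J, (X (f j) : MvPolynomial ℕ ℚ) ^ c j := by
  have hpos : ∀ x, 0 < Function.minimalPeriod σ x := fun x =>
    Function.minimalPeriod_pos_of_mem_periodicPts
      (σ.injective.mem_periodicPts x)
  have hfJ : ∀ j ∈ J, f j ∈ Finset.Icc 1 (Fintype.card α) := by
    intro j hj
    obtain ⟨x, rfl⟩ := hJ j hj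
    rw [Finset.mem_Icc, ← hf]
    exact ⟨hpos x, Function.minimalPeriod_le_card⟩
  unfold cycleMonomial
  rw [← Finset.prod_fiberwise_of_maps_to hfJ]
  refine Finset.prod_congr rfl fun i hi => ?_
  have hi1 := (Finset.mem_Icc.1 hi).1
  have : cycleCount σ i = ∑ j ∈ J with f j = i, c j := by
    refine Nat.eq_of_mul_eq_mul_right hi1 ?_
    rw [cycleCount_mul_eq_card_minimalPeriod σ hi1, Finset.sum_mul,
      Finset.card_eq_sum_card_fiberwise (f := m) (t := J.filter fun j => f j = i)]
    · refine Finset.sum_congr rfl fun j hj => ?_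
      obtain ⟨hjJ, rfl⟩ := Finset.mem_filter.1 hj
      rw [mul_comm, ← hc j hjJ]
      congr 1
      ext x
      simp only [Finset.mem_filter, Finset.mem_univ, true_and, hf]
      exact ⟨fun h => h.2, fun h => ⟨by rw [h], h⟩⟩
    · intro x hx
      simp only [Finset.coe_filter, Finset.mem_univ, true_and, Set.mem_ofPred_eq] at hx ⊢
      exact ⟨hm x, by rw [← hf, hx]⟩
  rw [this, ← Finset.prod_pow_eq_pow_sum]
  refine Finset.prod_congr rfl fun j hj => ?_
  rw [(Finset.mem_filter.1 hj).2]

theorem cycleMonomial_of_minimalPeriod_eq {α : Type*} [Fintype α] [DecidableEq α] [Nonempty α]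
    (σ : Equiv.Perm α) (l : ℕ) (h : ∀ x, Function.minimalPeriod σ x = l)
    (hl : l ∣ Fintype.card α) :
    cycleMonomial σ = (X l : MvPolynomial ℕ ℚ) ^ (Fintype.card α / l) := by
  rw [cycleMonomial_eq_prod σ {()} (fun _ => ()) (fun _ => l) (fun _ => Fintype.card α / l)
    (by simp) (by simp) (by simpa using h) ?_]
  · simp
  · simp [Nat.mul_div_cancel' hl]

/-! ### Periods of affine maps -/

theorem affinePerm_apply (p k : ℕ) [Fact p.Prime] (a b : ℤ) (ha : ¬ (p : ℤ) ∣ a)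
    (x : ZMod (p ^ k)) : affinePerm p k a b ha x = a * x + b := rfl

theorem affinePerm_iterate (p k : ℕ) [Fact p.Prime] (a b : ℤ) (ha : ¬ (p : ℤ) ∣ a)
    (x : ZMod (p ^ k)) (n : ℕ) :
    (affinePerm p k a b ha)^[n] x
      = x + ((∑ i ∈ Finset.range n, a ^ i : ℤ) : ZMod (p ^ k)) * ((a - 1) * x + b) := by
  induction n with
  | zero => simp
  | succ n ih =>
    rw [Function.iterate_succ_apply', ih, affinePerm_apply, geom_sum_succ]
    push_cast
    ring

theorem minimalPeriod_affinePerm_dvd_iff (p k : ℕ) [Fact p.Prime] (a b : ℤ)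
    (ha : ¬ (p : ℤ) ∣ a) (x : ZMod (p ^ k)) (n : ℕ) :
    Function.minimalPeriod (affinePerm p k a b ha) x ∣ n ↔
      (addOrderOf (((a : ZMod (p ^ k)) - 1) * x + b) : ℤ) ∣ ∑ i ∈ Finset.range n, a ^ i := by
  rw [← Function.isPeriodicPt_iff_minimalPeriod_dvd, Function.IsPeriodicPt, Function.IsFixedPt,
    affinePerm_iterate, addOrderOf_dvd_iff_zsmul_eq_zero, zsmul_eq_mul, add_eq_left]

theorem intCast_pow_eq_one_iff (a : ℤ) (d n : ℕ) :
    (a : ZMod d) ^ n = 1 ↔ (d : ℤ) ∣ a ^ n - 1 := by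
  rw [← ZMod.intCast_zmod_eq_zero_iff_dvd]
  push_cast
  exact sub_eq_zero.symm

theorem isUnit_intCast_of_not_dvd (p k : ℕ) [Fact p.Prime] {u : ℤ} (hu : ¬ (p : ℤ) ∣ u) :
    IsUnit (u : ZMod (p ^ k)) := by
  have hc : IsCoprime u ((p ^ k : ℕ) : ℤ) := by
    push_cast
    exact IsCoprime.pow_right
      ((Nat.prime_iff_prime_int.mp Fact.out).coprime_iff_not_dvd.mpr hu).symm
  exact (ZMod.unitOfIsCoprime u hc).isUnit

theorem orderOf_intCast_dvd_totient (p : ℕ) [Fact p.Prime] (a : ℤ) (ha : ¬ (p : ℤ) ∣ a) (m : ℕ) :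
    orderOf (a : ZMod (p ^ m)) ∣ (p ^ m).totient := by
  obtain ⟨u, hu⟩ := isUnit_intCast_of_not_dvd p m ha
  rw [← hu, orderOf_units]
  exact orderOf_dvd_of_pow_eq_one (ZMod.pow_totient u)

/-- Here `(a - 1) * x + b = (a - 1) * (x - y)`, and `(a - 1) * S_n = a^n - 1`, so returning to `x`
means that `a^n - 1` kills `x - y`. -/
theorem minimalPeriod_affinePerm_of_fixed (p k : ℕ) [Fact p.Prime] (a b : ℤ)
    (ha : ¬ (p : ℤ) ∣ a) (y : ZMod (p ^ k)) (hy : a * y + b = y) (x : ZMod (p ^ k)) :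
    Function.minimalPeriod (affinePerm p k a b ha) x
      = orderOf (a : ZMod (addOrderOf (x - y))) := by
  refine eq_of_forall_dvd fun n => ?_
  rw [orderOf_dvd_iff_pow_eq_one, intCast_pow_eq_one_iff, ← geom_sum_mul,
    ← Function.isPeriodicPt_iff_minimalPeriod_dvd, Function.IsPeriodicPt, Function.IsFixedPt,
    affinePerm_iterate, addOrderOf_dvd_iff_zsmul_eq_zero, zsmul_eq_mul, add_eq_left]
  have : (((a : ZMod (p ^ k)) - 1) * x + b) = (a - 1) * (x - y) := by
    linear_combination hy
  rw [this]
  push_cast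
  rw [mul_assoc]

/-- Points are labelled by the additive order of `x - y`; a cyclic group has `φ(d)` elements of each
order `d` dividing its size. -/
theorem cycleMonomial_affinePerm_of_fixed (p k : ℕ) [Fact p.Prime] (a b : ℤ)
    (ha : ¬ (p : ℤ) ∣ a) (y : ZMod (p ^ k)) (hy : a * y + b = y) :
    cycleMonomial (affinePerm p k a b ha) =
      ∏ m ∈ Finset.range (k + 1), (X (orderOf (a : ZMod (p ^ m))) : MvPolynomial ℕ ℚ) ^
        ((p ^ m).totient / orderOf (a : ZMod (p ^ m))) := by
  have hp : p.Prime := Fact.out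
  have hcard : Fintype.card (ZMod (p ^ k)) = p ^ k := ZMod.card _
  have hcount : ∀ d ∈ (p ^ k).divisors,
      (Finset.univ.filter fun x : ZMod (p ^ k) => addOrderOf (x - y) = d).card = d.totient := by
    intro d hd
    rw [← IsAddCyclic.card_addOrderOf_eq_totient (α := ZMod (p ^ k)) (d := d)
      (by rw [hcard]; exact Nat.dvd_of_mem_divisors hd)]
    refine Finset.card_equiv (Equiv.subRight y) fun x => ?_
    simp
  rw [cycleMonomial_eq_prod _ (p ^ k).divisors (fun x => addOrderOf (x - y))
    (fun d => orderOf (a : ZMod d)) (fun d => d.totient / orderOf (a : ZMod d)),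
    Nat.prod_divisors_prime_pow hp]
  · intro x
    rw [Nat.mem_divisors]
    exact ⟨addOrderOf_dvd_card.trans hcard.dvd, pow_ne_zero _ hp.ne_zero⟩
  · intro d hd
    have h0 : 0 < d.totient := Nat.totient_pos.2 (Nat.pos_of_mem_divisors hd)
    rw [← hcount d hd, Finset.card_pos] at h0
    obtain ⟨x, hx⟩ := h0
    exact ⟨x, (Finset.mem_filter.1 hx).2⟩
  · exact minimalPeriod_affinePerm_of_fixed p k a b ha y hy
  · intro d hd
    rw [hcount d hd]
    obtain ⟨m, -, rfl⟩ := (Nat.mem_divisors_prime_pow hp k).1 hd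
    exact (Nat.mul_div_cancel' (orderOf_intCast_dvd_totient p a ha m)).symm

theorem cycleMonomial_affinePerm_of_minimalPeriod_eq (p k : ℕ) [Fact p.Prime] (a b : ℤ)
    (ha : ¬ (p : ℤ) ∣ a) (l : ℕ) (hl : l ∣ p ^ k)
    (h : ∀ x, Function.minimalPeriod (affinePerm p k a b ha) x = l) :
    cycleMonomial (affinePerm p k a b ha) = (X l : MvPolynomial ℕ ℚ) ^ (p ^ k / l) := by
  rw [cycleMonomial_of_minimalPeriod_eq _ l h (by rwa [ZMod.card]), ZMod.card]

/-! ### Truncated valuations, additive orders and fixed points -/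

theorem le_truncVal_iff {p k m : ℕ} {n : ℤ} : m ≤ truncVal p k n ↔ m ≤ k ∧ (p : ℤ) ^ m ∣ n := by
  unfold truncVal
  have hne : min (emultiplicity (p : ℤ) n) (k : ℕ∞) ≠ ⊤ :=
    ne_top_of_le_ne_top (ENat.natCast_ne_top k) (min_le_right _ _)
  rw [← Nat.cast_le (α := ℕ∞), ENat.natCast_toNat hne, le_min_iff, pow_dvd_iff_le_emultiplicity,
    Nat.cast_le, and_comm]

theorem truncVal_le (p k : ℕ) (n : ℤ) : truncVal p k n ≤ k := (le_truncVal_iff.1 le_rfl).1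

theorem pow_truncVal_dvd (p k : ℕ) (n : ℤ) : (p : ℤ) ^ truncVal p k n ∣ n :=
  (le_truncVal_iff.1 le_rfl).2

theorem truncVal_eq_of_emultiplicity_eq {p k l d : ℕ} {x y : ℤ} (hkl : k = d + l)
    (h : emultiplicity (p : ℤ) x = d + emultiplicity (p : ℤ) y) :
    truncVal p k x = d + truncVal p l y := by
  have hne : min (emultiplicity (p : ℤ) y) (l : ℕ∞) ≠ ⊤ :=
    ne_top_of_le_ne_top (ENat.natCast_ne_top l) (min_le_right _ _)
  unfold truncVal
  rw [h, hkl, Nat.cast_add, min_add_add_left, ENat.toNat_add (ENat.natCast_ne_top d) hne,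
    ENat.toNat_natCast]

theorem truncVal_congr {p k : ℕ} {x y : ℤ} (h : ∀ m ≤ k, (p : ℤ) ^ m ∣ x ↔ (p : ℤ) ^ m ∣ y) :
    truncVal p k x = truncVal p k y := by
  refine eq_of_forall_le_iff fun m => ?_
  rw [le_truncVal_iff, le_truncVal_iff]
  exact and_congr_right (h m)

theorem truncVal_eq_of_dvd_sub {p k : ℕ} {x y : ℤ} (h : (p : ℤ) ^ k ∣ x - y) :
    truncVal p k x = truncVal p k y := by
  refine truncVal_congr fun m hm => ?_
  have := (pow_dvd_pow (p : ℤ) hm).trans h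
  exact (dvd_iff_dvd_of_dvd_sub this)

theorem truncVal_add_of_lt {p k : ℕ} {x y : ℤ} (h : truncVal p k x < truncVal p k y) :
    truncVal p k (x + y) = truncVal p k x := by
  refine truncVal_congr fun m hm => ?_
  rcases le_or_gt m (truncVal p k y) with h1 | h1
  · rw [dvd_add_left (le_truncVal_iff.1 h1).2]
  · have hx : ¬ (p : ℤ) ^ truncVal p k y ∣ x := fun hd =>
      absurd (le_truncVal_iff.2 ⟨truncVal_le _ _ _, hd⟩) (not_le.2 h)
    refine iff_of_false (fun hd => hx ?_) (fun hd => hx ((pow_dvd_pow _ h1.le).trans hd))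
    exact (dvd_add_left (pow_truncVal_dvd p k y)).1 ((pow_dvd_pow _ h1.le).trans hd)

theorem exists_eq_pow_truncVal_mul {p k : ℕ} {n : ℤ} (h : truncVal p k n < k) :
    ∃ u : ℤ, n = (p : ℤ) ^ truncVal p k n * u ∧ ¬ (p : ℤ) ∣ u := by
  obtain ⟨u, hu⟩ := pow_truncVal_dvd p k n
  refine ⟨u, hu, fun hd => ?_⟩
  have : truncVal p k n + 1 ≤ truncVal p k n := by
    refine le_truncVal_iff.2 ⟨h, ?_⟩
    rw [pow_succ]
    conv_rhs => rw [hu]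
    exact mul_dvd_mul_left _ hd
  omega

theorem emultiplicity_eq_truncVal {p k : ℕ} {n : ℤ} (h : truncVal p k n < k) :
    emultiplicity (p : ℤ) n = truncVal p k n := by
  refine emultiplicity_eq_coe.2 ⟨pow_truncVal_dvd p k n, fun hd => ?_⟩
  have := le_truncVal_iff.2 ⟨h, hd⟩
  omega

theorem addOrderOf_intCast (p k : ℕ) [hp : Fact p.Prime] (z : ℤ) :
    addOrderOf (z : ZMod (p ^ k)) = p ^ (k - truncVal p k z) := by
  refine eq_of_forall_dvd fun n => ?_
  rw [addOrderOf_dvd_iff_nsmul_eq_zero, nsmul_eq_mul]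
  have hc : (n : ZMod (p ^ k)) * z = ((n * z : ℤ) : ZMod (p ^ k)) := by push_cast; rfl
  rw [hc, ZMod.intCast_zmod_eq_zero_iff_dvd, ← Int.natCast_dvd_natCast]
  push_cast
  rcases (truncVal_le p k z).eq_or_lt with h | h
  · rw [h, Nat.sub_self, pow_zero]
    refine iff_of_true (Dvd.dvd.mul_left ?_ _) (one_dvd _)
    have := pow_truncVal_dvd p k z
    rwa [h] at this
  · obtain ⟨u, hu, hpu⟩ := exists_eq_pow_truncVal_mul h
    have hp' : Prime (p : ℤ) := Nat.prime_iff_prime_int.mp hp.out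
    generalize truncVal p k z = t at *
    subst hu
    rw [← Nat.add_sub_of_le h.le, pow_add, mul_left_comm, Nat.add_sub_cancel_left,
      mul_dvd_mul_iff_left (pow_ne_zero _ hp'.ne_zero)]
    exact ⟨fun h => ((hp'.coprime_iff_not_dvd.2 hpu).pow_left).dvd_of_dvd_mul_right h,
      fun h => h.mul_right _⟩

theorem exists_affine_fixed {p k : ℕ} [Fact p.Prime] {a b : ℤ}
    (h : truncVal p k (a - 1) ≤ truncVal p k b) :
    ∃ y : ZMod (p ^ k), a * y + b = y := by
  rcases (truncVal_le p k (a - 1)).eq_or_lt with hk | hk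
  · have h1 := pow_truncVal_dvd p k (a - 1)
    have h2 := pow_truncVal_dvd p k b
    rw [hk] at h1 h
    rw [(truncVal_le p k b).antisymm h] at h2
    refine ⟨0, ?_⟩
    rw [mul_zero, zero_add, ZMod.intCast_zmod_eq_zero_iff_dvd]
    exact_mod_cast h2
  · obtain ⟨u, hu, hpu⟩ := exists_eq_pow_truncVal_mul hk
    obtain ⟨v, hv⟩ := (le_truncVal_iff.1 h).2
    obtain ⟨i, hi⟩ := (isUnit_intCast_of_not_dvd p k hpu).exists_right_inv
    -- With `a - 1 = p^w * u`, `b = p^w * v` and `i` inverse to `u`, this solves `(a - 1) * y = -b`.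
    refine ⟨-(i * v), ?_⟩
    have hu' : (a : ZMod (p ^ k)) - 1 = p ^ truncVal p k (a - 1) * u := by
      exact_mod_cast congrArg (Int.cast : ℤ → ZMod (p ^ k)) hu
    have hv' : (b : ZMod (p ^ k)) = p ^ truncVal p k (a - 1) * v := by
      exact_mod_cast congrArg (Int.cast : ℤ → ZMod (p ^ k)) hv
    linear_combination (-(i * v) : ZMod (p ^ k)) * hu' + hv' - p ^ truncVal p k (a - 1) * v * hi

/-! ### Lifting the exponent and multiplicative orders -/

/-- The conclusion of the lifting-the-exponent lemma for the powers of `a`. -/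
def LiftsExponent (p : ℕ) (a : ℤ) : Prop :=
  ∀ n : ℕ, emultiplicity (p : ℤ) (a ^ n - 1)
    = emultiplicity (p : ℤ) (a - 1) + emultiplicity (p : ℤ) (n : ℤ)

theorem liftsExponent_of_odd {p : ℕ} [hp : Fact p.Prime] (hp2 : p ≠ 2) {a : ℤ}
    (h : (p : ℤ) ∣ a - 1) : LiftsExponent p a := by
  intro n
  have ha : ¬ (p : ℤ) ∣ a := fun hd => (Nat.prime_iff_prime_int.mp hp.out).not_dvd_one
    ((dvd_sub_right hd).1 h)
  have := Int.emultiplicity_pow_sub_pow hp.out (hp.out.odd_of_ne_two hp2) h ha n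
  rwa [one_pow, ← Int.natCast_emultiplicity] at this

theorem liftsExponent_two {a : ℤ} (h : 4 ∣ a - 1) : LiftsExponent 2 a := by
  intro n
  have := Int.two_pow_sub_pow' n h (by omega)
  rwa [one_pow] at this

theorem LiftsExponent.dvd_iff {p : ℕ} {a : ℤ} (H : LiftsExponent p a) {k m : ℕ} (hm : m ≤ k)
    (n : ℕ) : (p : ℤ) ^ m ∣ a ^ n - 1 ↔ p ^ (m - truncVal p k (a - 1)) ∣ n := by
  rcases (truncVal_le p k (a - 1)).eq_or_lt with h | h
  · rw [h, Nat.sub_eq_zero_of_le hm, pow_zero]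
    refine iff_of_true ?_ (one_dvd _)
    have := pow_truncVal_dvd p k (a - 1)
    rw [h] at this
    exact ((pow_dvd_pow _ hm).trans this).trans (sub_one_dvd_pow_sub_one a n)
  · rw [pow_dvd_iff_le_emultiplicity, H n, emultiplicity_eq_truncVal h, ← Int.natCast_dvd_natCast]
    push_cast
    rw [pow_dvd_iff_le_emultiplicity, ENat.natCast_sub, tsub_le_iff_left]

/-- Cancelling the valuation of `a - 1` from `(a - 1) * S_n = a^n - 1` leaves `ν(S_n) = ν(n)`. For
`a = 1` that valuation is infinite and cannot be cancelled, but then `S_n = n`. -/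
theorem LiftsExponent.dvd_geom_sum_iff {p : ℕ} {a : ℤ} (H : LiftsExponent p a) (hp : Prime (p : ℤ))
    (m n : ℕ) : (p : ℤ) ^ m ∣ ∑ i ∈ Finset.range n, a ^ i ↔ p ^ m ∣ n := by
  rw [← Int.natCast_dvd_natCast]
  rcases eq_or_ne a 1 with rfl | ha
  · simp
  · have h := H n
    have hfin : FiniteMultiplicity (p : ℤ) (a - 1) :=
      FiniteMultiplicity.of_prime_left hp (sub_ne_zero.2 ha)
    rw [← mul_geom_sum, emultiplicity_mul hp] at h
    have := WithTop.add_left_cancel (finiteMultiplicity_iff_emultiplicity_ne_top.1 hfin) h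
    push_cast
    rw [pow_dvd_iff_le_emultiplicity, pow_dvd_iff_le_emultiplicity, this]

/-- If `p` lifts exponents for `a ^ o` and `o` divides every exponent `n` with
`a ^ n ≡ 1 mod p ^ m`, this computes the order of `a` modulo `p ^ m`. -/
theorem orderOf_intCast_eq {p : ℕ} {a : ℤ} {o k m : ℕ} (ho : 0 < o) (H : LiftsExponent p (a ^ o))
    (hm : m ≤ k) (hdvd : ∀ n : ℕ, (p : ℤ) ^ m ∣ a ^ n - 1 → o ∣ n) :
    orderOf (a : ZMod (p ^ m)) = o * p ^ (m - truncVal p k (a ^ o - 1)) := by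
  refine eq_of_forall_dvd fun n => ?_
  rw [orderOf_dvd_iff_pow_eq_one, intCast_pow_eq_one_iff]
  push_cast
  constructor
  · intro h
    obtain ⟨n, rfl⟩ := hdvd n h
    rw [pow_mul, H.dvd_iff hm] at h
    exact mul_dvd_mul_left o h
  · intro h
    obtain ⟨n, rfl⟩ := (dvd_mul_right _ _).trans h
    rw [pow_mul, H.dvd_iff hm]
    exact (mul_dvd_mul_iff_left ho.ne').1 h

theorem sum_range_totient_prime_pow {p : ℕ} (hp : p.Prime) (j : ℕ) :
    ∑ m ∈ Finset.range (j + 1), (p ^ m).totient = p ^ j := by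
  rw [← Nat.sum_divisors_prime_pow (f := Nat.totient) hp, Nat.sum_totient]

theorem sum_Ico_totient_prime_pow {p : ℕ} (hp : p.Prime) {i j : ℕ} (hij : i ≤ j) :
    ∑ m ∈ Finset.Ico (i + 1) (j + 1), (p ^ m).totient = p ^ j - p ^ i := by
  have h := Finset.sum_range_add_sum_Ico (fun m => (p ^ m).totient) (Nat.add_le_add_right hij 1)
  rw [sum_range_totient_prime_pow hp, sum_range_totient_prime_pow hp] at h
  omega

/-! ### Cycle types from orders; the odd case -/

/-- The product over `m` splits into three ranges. The order is `1` for `m ≤ i` and `o` for `i < m ≤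
c`, where the totients sum to `p^i` and `p^c - p^i`; for `m = c + s` it is `o * p^s`, and `p^s`
cancels from the totient. It is used with `i = c` when `a` lifts exponents, `i = 0` for odd `p` with
`a ≢ 1`, and `i = 1` for `p = 2` with `a ≡ 3` mod `4`. -/
theorem cycleMonomial_affinePerm_of_orderOf (p k : ℕ) [hp : Fact p.Prime] (a b : ℤ)
    (ha : ¬ (p : ℤ) ∣ a) (y : ZMod (p ^ k)) (hy : a * y + b = y) (o c i : ℕ)
    (hc : 1 ≤ c) (hic : i ≤ c) (hck : c ≤ k) (h1 : ∀ m ≤ i, orderOf (a : ZMod (p ^ m)) = 1)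
    (h2 : ∀ m ≤ k, i < m → orderOf (a : ZMod (p ^ m)) = o * p ^ (m - c)) :
    cycleMonomial (affinePerm p k a b ha) =
      (X 1 : MvPolynomial ℕ ℚ) ^ p ^ i * X o ^ ((p ^ c - p ^ i) / o)
        * ∏ s ∈ Finset.Icc 1 (k - c), X (o * p ^ s) ^ (p ^ (c - 1) * (p - 1) / o) := by
  rw [cycleMonomial_affinePerm_of_fixed p k a b ha y hy,
    ← Finset.prod_range_mul_prod_Ico _ (Nat.add_le_add_right hck 1),
    ← Finset.prod_range_mul_prod_Ico _ (Nat.add_le_add_right hic 1)]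
  congr 1
  · congr 1
    · rw [← sum_range_totient_prime_pow hp.out i, ← Finset.prod_pow_eq_pow_sum]
      refine Finset.prod_congr rfl fun m hm => ?_
      rw [h1 m (Nat.lt_succ_iff.1 (Finset.mem_range.1 hm)), Nat.div_one]
    · have hord : ∀ m ∈ Finset.Ico (i + 1) (c + 1), orderOf (a : ZMod (p ^ m)) = o := by
        intro m hm
        rw [Finset.mem_Ico] at hm
        rw [h2 m (by omega) (by omega), Nat.sub_eq_zero_of_le (by omega), pow_zero, mul_one]
      rw [← sum_Ico_totient_prime_pow hp.out hic, Nat.sum_div, ← Finset.prod_pow_eq_pow_sum]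
      · exact Finset.prod_congr rfl fun m hm => by rw [hord m hm]
      · intro m hm
        rw [← hord m hm]
        exact orderOf_intCast_dvd_totient p a ha m
  · rw [← Finset.Ico_add_one_right_eq_Icc]
    have hk : k + 1 = k - c + 1 + c := by omega
    rw [hk, add_comm c 1, ← Finset.prod_Ico_add']
    refine Finset.prod_congr rfl fun s hs => ?_
    rw [Finset.mem_Ico] at hs
    rw [h2 (s + c) (by omega) (by omega), Nat.add_sub_cancel,
      Nat.totient_prime_pow hp.out (by omega)]
    congr 1
    have : s + c - 1 = s + (c - 1) := by omega
    rw [this, pow_add, mul_comm o, mul_assoc, Nat.mul_div_mul_left _ _ (pow_pos hp.out.pos s)]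

theorem cycleMonomial_affinePerm_of_eq_one (p k : ℕ) [Fact p.Prime] (a b : ℤ)
    (ha : ¬ (p : ℤ) ∣ a) (h1 : (a : ZMod (p ^ k)) = 1) :
    cycleMonomial (affinePerm p k a b ha) = (X (addOrderOf (b : ZMod (p ^ k))) :
      MvPolynomial ℕ ℚ) ^ (p ^ k / addOrderOf (b : ZMod (p ^ k))) := by
  refine cycleMonomial_affinePerm_of_minimalPeriod_eq p k a b ha _ ?_ fun x => ?_
  · exact addOrderOf_dvd_card.trans (ZMod.card _).dvd
  · refine eq_of_forall_dvd fun n => ?_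
    rw [minimalPeriod_affinePerm_dvd_iff, addOrderOf_dvd_iff_zsmul_eq_zero,
      addOrderOf_dvd_iff_nsmul_eq_zero, zsmul_eq_mul, nsmul_eq_mul]
    simp [h1]

theorem LiftsExponent.cycleMonomial_of_lt {p k : ℕ} [hp : Fact p.Prime] {a b : ℤ}
    (H : LiftsExponent p a) (ha : ¬ (p : ℤ) ∣ a) (h : truncVal p k b < truncVal p k (a - 1)) :
    cycleMonomial (affinePerm p k a b ha) = (X (addOrderOf (b : ZMod (p ^ k))) :
      MvPolynomial ℕ ℚ) ^ (p ^ k / addOrderOf (b : ZMod (p ^ k))) := by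
  refine cycleMonomial_affinePerm_of_minimalPeriod_eq p k a b ha _ ?_ fun x => ?_
  · exact addOrderOf_dvd_card.trans (ZMod.card _).dvd
  · refine eq_of_forall_dvd fun n => ?_
    obtain ⟨x, rfl⟩ := ZMod.intCast_surjective x
    have hz : ((a : ZMod (p ^ k)) - 1) * x + b = ((b + (a - 1) * x : ℤ) : ZMod (p ^ k)) := by
      push_cast; ring
    have hx : truncVal p k (a - 1) ≤ truncVal p k ((a - 1) * x) :=
      le_truncVal_iff.2 ⟨truncVal_le _ _ _, (pow_truncVal_dvd _ _ _).mul_right _⟩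
    rw [minimalPeriod_affinePerm_dvd_iff, hz, addOrderOf_intCast, addOrderOf_intCast,
      truncVal_add_of_lt (h.trans_le hx)]
    push_cast
    exact H.dvd_geom_sum_iff (Nat.prime_iff_prime_int.mp hp.out) _ _

theorem LiftsExponent.cycleMonomial_of_le {p k : ℕ} [hp : Fact p.Prime] {a b : ℤ}
    (H : LiftsExponent p a) (ha : ¬ (p : ℤ) ∣ a) (hw : 1 ≤ truncVal p k (a - 1))
    (h : truncVal p k (a - 1) ≤ truncVal p k b) :
    cycleMonomial (affinePerm p k a b ha) =
      (X 1 : MvPolynomial ℕ ℚ) ^ p ^ truncVal p k (a - 1)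
        * ∏ s ∈ Finset.Icc 1 (k - truncVal p k (a - 1)),
            X (p ^ s) ^ (p ^ (truncVal p k (a - 1) - 1) * (p - 1)) := by
  obtain ⟨y, hy⟩ := exists_affine_fixed h
  have hord : ∀ m ≤ k, orderOf (a : ZMod (p ^ m)) = 1 * p ^ (m - truncVal p k (a - 1)) := by
    intro m hm
    have := orderOf_intCast_eq (a := a) (o := 1) one_pos (by rwa [pow_one]) hm
      (fun n _ => one_dvd n)
    rwa [pow_one] at this
  rw [cycleMonomial_affinePerm_of_orderOf p k a b ha y hy 1 (truncVal p k (a - 1))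
    (truncVal p k (a - 1)) hw le_rfl (truncVal_le _ _ _)
    (fun m hm => by
      rw [hord m (hm.trans (truncVal_le _ _ _)), Nat.sub_eq_zero_of_le hm, pow_zero, one_mul])
    (fun m hm _ => hord m hm)]
  simp

theorem cycleMonomial_affinePerm_of_not_modEq_one {p k : ℕ} [hp : Fact p.Prime] (hp2 : p ≠ 2)
    (hk : 1 ≤ k) {a : ℤ} (b : ℤ) (ha : ¬ (p : ℤ) ∣ a) (ha1 : ¬ a ≡ 1 [ZMOD p]) :
    cycleMonomial (affinePerm p k a b ha) =
      X 1 ^ 1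
        * X (ordCompl[p] (orderOf (a : ZMod (p ^ k)))) ^
            ((p ^ (k - (orderOf (a : ZMod (p ^ k))).factorization p) - 1)
              / ordCompl[p] (orderOf (a : ZMod (p ^ k))))
        * ∏ s ∈ Finset.Icc 1 ((orderOf (a : ZMod (p ^ k))).factorization p),
            X (ordCompl[p] (orderOf (a : ZMod (p ^ k))) * p ^ s) ^
              (p ^ (k - 1 - (orderOf (a : ZMod (p ^ k))).factorization p) * (p - 1)
                / ordCompl[p] (orderOf (a : ZMod (p ^ k)))) := by
  have hw : truncVal p k (a - 1) = 0 := by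
    by_contra h
    have := (le_truncVal_iff.1 (Nat.one_le_iff_ne_zero.2 h)).2
    rw [pow_one] at this
    exact ha1 (Int.modEq_iff_dvd.2 (by rwa [← dvd_neg, neg_sub]))
  obtain ⟨y, hy⟩ := exists_affine_fixed (p := p) (k := k) (a := a) (b := b) (by omega)
  set o := orderOf (a : ZMod (p ^ 1)) with ho_def
  have hod : o ∣ p - 1 := by
    have := orderOf_intCast_dvd_totient p a ha 1
    rwa [← ho_def, pow_one, Nat.totient_prime hp.out] at this
  have hp1 : 0 < p - 1 := Nat.sub_pos_of_lt hp.out.one_lt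
  have ho : 0 < o := Nat.pos_of_dvd_of_pos hod hp1
  -- As `o` is prime to `p`, it is the `p'`-part of `ord(a) = o * p^(k - c)`; hence `v = k - c`.
  have hpo : ¬ p ∣ o := fun h => by
    have := Nat.le_of_dvd hp1 (h.trans hod)
    omega
  have hiff : ∀ n : ℕ, (p : ℤ) ∣ a ^ n - 1 ↔ o ∣ n := by
    intro n
    rw [ho_def, orderOf_dvd_iff_pow_eq_one, intCast_pow_eq_one_iff]
    push_cast
    rw [pow_one]
  have hpd : (p : ℤ) ∣ a ^ o - 1 := (hiff o).2 dvd_rfl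
  set c := truncVal p k (a ^ o - 1) with hc_def
  have hck : c ≤ k := truncVal_le _ _ _
  have hc : 1 ≤ c := le_truncVal_iff.2 ⟨hk, by rwa [pow_one]⟩
  have hord : ∀ m ≤ k, 0 < m → orderOf (a : ZMod (p ^ m)) = o * p ^ (m - c) := by
    intro m hm hm0
    refine orderOf_intCast_eq ho (liftsExponent_of_odd hp2 hpd) hm fun n hn => ?_
    exact (hiff n).1 ((dvd_pow_self _ hm0.ne').trans hn)
  have hfac : (orderOf (a : ZMod (p ^ k))).factorization p = k - c := by
    rw [hord k le_rfl hk, Nat.factorization_mul ho.ne' (pow_ne_zero _ hp.out.ne_zero),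
      Finsupp.add_apply, Nat.factorization_eq_zero_of_not_dvd hpo, zero_add,
      hp.out.factorization_pow, Finsupp.single_eq_same]
  have hcompl : ordCompl[p] (orderOf (a : ZMod (p ^ k))) = o := by
    rw [hfac, hord k le_rfl hk, Nat.mul_div_cancel _ (pow_pos hp.out.pos _)]
  rw [hcompl, hfac, Nat.sub_sub_self hck]
  have hkc : k - 1 - (k - c) = c - 1 := by omega
  rw [hkc, cycleMonomial_affinePerm_of_orderOf p k a b ha y hy o c 0 hc (Nat.zero_le _) hck
    (fun m hm => ?_) hord, pow_zero]
  obtain rfl := Nat.le_zero.1 hm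
  rw [orderOf_eq_one_iff, pow_zero]
  exact Subsingleton.elim _ _

/-! ### The prime `2` with `a ≡ 3` mod `4` -/

/-- For odd `n`, `a + 1` divides `a^n + 1`, so `a^n ≡ -1` mod `4`. -/
theorem two_dvd_of_four_dvd_pow_sub_one {a : ℤ} (h : 4 ∣ a + 1) {n : ℕ} (hn : 4 ∣ a ^ n - 1) :
    2 ∣ n := by
  by_contra hodd
  have h1 : a + 1 ∣ a ^ n + 1 ^ n :=
    Odd.add_dvd_pow_add_pow a 1 (Nat.not_even_iff_odd.1 fun he => hodd he.two_dvd)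
  have h2 := h.trans h1
  rw [one_pow] at h2
  omega

theorem four_dvd_sq_sub_one {a : ℤ} (h : 4 ∣ a + 1) : 4 ∣ a ^ 2 - 1 := by
  have : a ^ 2 - 1 = (a + 1) * (a - 1) := by ring
  rw [this]
  exact h.mul_right _

/-- Exponents lift for `a^2`, which is `1` mod `4`, though not for `a` itself; hence `o = 2`. -/
theorem orderOf_intCast_two_pow {a : ℤ} (h : 4 ∣ a + 1) {k m : ℕ} (hm : 2 ≤ m) (hmk : m ≤ k) :
    orderOf (a : ZMod (2 ^ m)) = 2 * 2 ^ (m - truncVal 2 k (a ^ 2 - 1)) := by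
  have h4 := four_dvd_sq_sub_one h
  refine orderOf_intCast_eq two_pos (liftsExponent_two h4) hmk fun n hn => ?_
  exact two_dvd_of_four_dvd_pow_sub_one h ((pow_dvd_pow (2 : ℤ) hm).trans hn)

theorem intCast_zmod_two_pow_one {a : ℤ} (ha : ¬ ((2 : ℕ) : ℤ) ∣ a) :
    (a : ZMod (2 ^ 1)) = 1 := by
  have h1 : (a : ZMod (2 ^ 1)) ^ 1 = 1 := by
    rw [intCast_pow_eq_one_iff]
    simp only [Nat.cast_ofNat, pow_one]
    omega
  exact (pow_one _).symm.trans h1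

theorem cycleMonomial_affinePerm_two_of_even {k : ℕ} (hk : 2 ≤ k) {a b : ℤ}
    (ha : ¬ ((2 : ℕ) : ℤ) ∣ a) (h : 4 ∣ a + 1) (hb : 2 ∣ b) :
    cycleMonomial (affinePerm 2 k a b ha) =
      (X 1 : MvPolynomial ℕ ℚ) ^ 2 * X 2 ^ (2 ^ (truncVal 2 k (a ^ 2 - 1) - 1) - 1)
        * ∏ s ∈ Finset.Icc 2 (k + 1 - truncVal 2 k (a ^ 2 - 1)),
            X (2 ^ s) ^ 2 ^ (truncVal 2 k (a ^ 2 - 1) - 2) := by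
  have h4 := four_dvd_sq_sub_one h
  have hc2 : 2 ≤ truncVal 2 k (a ^ 2 - 1) := le_truncVal_iff.2 ⟨hk, h4⟩
  have hck := truncVal_le 2 k (a ^ 2 - 1)
  have hw : truncVal 2 k (a - 1) ≤ truncVal 2 k b := by
    have h1 : truncVal 2 k (a - 1) < 2 := by
      by_contra hlt
      have h5 : (4 : ℤ) ∣ a - 1 := (le_truncVal_iff.1 (not_lt.1 hlt)).2
      omega
    have h2 : 1 ≤ truncVal 2 k b := le_truncVal_iff.2 ⟨by omega, by simpa using hb⟩
    omega
  obtain ⟨y, hy⟩ := exists_affine_fixed hw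
  rw [cycleMonomial_affinePerm_of_orderOf 2 k a b ha y hy 2 (truncVal 2 k (a ^ 2 - 1)) 1
    (by omega) (by omega) hck ?_ (fun m hm hm1 => orderOf_intCast_two_pow h hm1 hm)]
  · generalize truncVal 2 k (a ^ 2 - 1) = c at *
    obtain ⟨c, rfl⟩ := Nat.exists_eq_add_of_le' hc2
    have e1 : (2 ^ (c + 2) - 2 ^ 1) / 2 = 2 ^ (c + 2 - 1) - 1 := by
      have e0 : c + 2 - 1 = c + 1 := rfl
      rw [e0, pow_succ _ (c + 1)]
      omega
    have e2 : 2 ^ (c + 2 - 1) * (2 - 1) / 2 = 2 ^ (c + 2 - 2) := by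
      have e0 : c + 2 - 1 = c + 1 := rfl
      rw [e0, Nat.add_sub_cancel, pow_succ]
      omega
    rw [e1, e2, pow_one, ← Finset.Ico_add_one_right_eq_Icc, ← Finset.Ico_add_one_right_eq_Icc]
    -- The length `2 * 2^s` is `2^(s + 1)`, so the index of the product moves up by one.
    have e3 : k + 1 - (c + 2) + 1 = k - (c + 2) + 1 + 1 := by omega
    rw [e3, ← Finset.prod_Ico_add' _ 1 (k - (c + 2) + 1) 1]
    simp only [pow_succ']
  · intro m hm
    rw [orderOf_eq_one_iff]
    interval_cases m
    · exact Subsingleton.elim (α := ZMod 1) _ _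
    · exact intCast_zmod_two_pow_one ha

/-- Writing `a - 1 = 2 * u` with `u` odd, `2^k` divides `S_n` iff `2^(k+1)` divides `(a - 1) * S_n =
a^n - 1`. This is why the valuation is truncated at `k + 1`. -/
theorem cycleMonomial_affinePerm_two_of_odd {k : ℕ} (hk : 2 ≤ k) {a b : ℤ}
    (ha : ¬ ((2 : ℕ) : ℤ) ∣ a) (h : 4 ∣ a + 1) (hb : ¬ 2 ∣ b) :
    cycleMonomial (affinePerm 2 k a b ha) =
      (X (2 ^ (k + 2 - truncVal 2 (k + 1) (a ^ 2 - 1))) : MvPolynomial ℕ ℚ)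
        ^ 2 ^ (truncVal 2 (k + 1) (a ^ 2 - 1) - 2) := by
  have h8 : (8 : ℤ) ∣ a ^ 2 - 1 := Int.eight_dvd_sq_sub_one_of_odd (Int.not_even_iff_odd.1
    fun he => ha (by exact_mod_cast he.two_dvd))
  have hc3 : 3 ≤ truncVal 2 (k + 1) (a ^ 2 - 1) := le_truncVal_iff.2 ⟨by omega, h8⟩
  have hck := truncVal_le 2 (k + 1) (a ^ 2 - 1)
  have hord := orderOf_intCast_two_pow h (show 2 ≤ k + 1 by omega) le_rfl
  have hl : 2 * 2 ^ (k + 1 - truncVal 2 (k + 1) (a ^ 2 - 1))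
      = 2 ^ (k + 2 - truncVal 2 (k + 1) (a ^ 2 - 1)) := by
    rw [← pow_succ']
    congr 1
    omega
  rw [hl] at hord
  rw [cycleMonomial_affinePerm_of_minimalPeriod_eq 2 k a b ha
    (2 ^ (k + 2 - truncVal 2 (k + 1) (a ^ 2 - 1))) (pow_dvd_pow _ (by omega)),
    Nat.pow_div (by omega) two_pos]
  · congr 2
    omega
  · intro x
    rw [← hord]
    refine eq_of_forall_dvd fun n => ?_
    obtain ⟨x, rfl⟩ := ZMod.intCast_surjective x
    have hz : ((a : ZMod (2 ^ k)) - 1) * x + b = (((a - 1) * x + b : ℤ) : ZMod (2 ^ k)) := by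
      push_cast; ring
    have h0 : truncVal 2 k ((a - 1) * x + b) = 0 := by
      by_contra hne
      have h1 := (le_truncVal_iff.1 (Nat.one_le_iff_ne_zero.2 hne)).2
      have h2 : (2 : ℤ) ∣ (a - 1) * x := Dvd.dvd.mul_right (by omega) x
      rw [pow_one] at h1
      exact hb ((dvd_add_right h2).1 h1)
    obtain ⟨u, hu⟩ : (2 : ℤ) ∣ a - 1 := by omega
    have hu2 : IsCoprime ((2 : ℤ) ^ k) u := by
      refine IsCoprime.pow_left ((Int.prime_two.coprime_iff_not_dvd).2 ?_)
      omega
    rw [minimalPeriod_affinePerm_dvd_iff, hz, addOrderOf_intCast, h0, Nat.sub_zero,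
      orderOf_dvd_iff_pow_eq_one, intCast_pow_eq_one_iff, ← mul_geom_sum, hu]
    push_cast
    rw [pow_succ', mul_assoc, mul_dvd_mul_iff_left two_ne_zero]
    exact ⟨fun h => h.mul_left _, fun h => hu2.dvd_of_dvd_mul_left h⟩

/-! ### Signed powers of `5` modulo `2^k` -/

theorem emultiplicity_two_five_pow_sub_one (e : ℕ) :
    emultiplicity ((2 : ℕ) : ℤ) (5 ^ e - 1) = (2 : ℕ) + emultiplicity ((2 : ℕ) : ℤ) (e : ℤ) := by
  rw [liftsExponent_two (a := 5) (by norm_num) e]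
  congr 1
  exact emultiplicity_eq_coe.2 ⟨by norm_num, by norm_num⟩

theorem truncVal_two_five_pow_sub_one {k : ℕ} (hk : 2 ≤ k) (e : ℕ) :
    truncVal 2 k (5 ^ e - 1) = 2 + truncVal 2 (k - 2) e :=
  truncVal_eq_of_emultiplicity_eq (by omega) (emultiplicity_two_five_pow_sub_one e)

theorem truncVal_two_five_pow_sq_sub_one {k : ℕ} (hk : 3 ≤ k) (e : ℕ) :
    truncVal 2 k ((5 ^ e) ^ 2 - 1) = 3 + truncVal 2 (k - 3) e := by
  refine truncVal_eq_of_emultiplicity_eq (by omega) ?_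
  rw [← pow_mul, emultiplicity_two_five_pow_sub_one]
  push_cast
  rw [emultiplicity_mul Int.prime_two,
    (FiniteMultiplicity.of_prime_left Int.prime_two two_ne_zero).emultiplicity_self, add_comm _ 1,
    ← add_assoc]
  rfl

theorem four_dvd_five_pow_sub_one (e : ℕ) : (4 : ℤ) ∣ 5 ^ e - 1 := by
  simpa using sub_one_dvd_pow_sub_one (5 : ℤ) e

theorem orderOf_five_zmod_two_pow {k : ℕ} (hk : 2 ≤ k) :
    orderOf (5 : ZMod (2 ^ k)) = 2 ^ (k - 2) := by
  obtain ⟨n, rfl⟩ := Nat.exists_eq_add_of_le' hk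
  simpa using ZMod.orderOf_five n

theorem intCast_eq_neg_one_pow_mul_five_pow_iff (a : ℤ) (k ε e : ℕ) :
    (a : ZMod (2 ^ k)) = (-1) ^ ε * 5 ^ e ↔ (2 : ℤ) ^ k ∣ a - (-1) ^ ε * 5 ^ e := by
  have := ZMod.intCast_zmod_eq_zero_iff_dvd (a - (-1) ^ ε * 5 ^ e) (2 ^ k)
  push_cast at this
  rw [← this, sub_eq_zero]

/-- Since `5^e ≡ 1` mod `4`, the sign is read off mod `4`; the exponent is then determined below the
order `2^(k-2)` of `5`. -/
theorem injOn_neg_one_pow_mul_five_pow {k : ℕ} (hk : 2 ≤ k) :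
    Set.InjOn (fun x : ℕ × ℕ => (-1 : ZMod (2 ^ k)) ^ x.1 * 5 ^ x.2)
      (Finset.range 2 ×ˢ Finset.range (2 ^ (k - 2)) : Finset (ℕ × ℕ)) := by
  rintro ⟨ε, e⟩ h ⟨δ, f⟩ h' heq
  simp only [Finset.coe_product, Finset.coe_range, Set.mem_prod, Set.mem_Iio] at h h'
  have hd : (4 : ℤ) ∣ (-1) ^ ε * 5 ^ e - (-1) ^ δ * 5 ^ f := by
    have := (intCast_eq_neg_one_pow_mul_five_pow_iff ((-1) ^ ε * 5 ^ e) k δ f).1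
      (by push_cast; exact heq)
    exact (pow_dvd_pow (2 : ℤ) hk).trans this
  have he := four_dvd_five_pow_sub_one e
  have hf := four_dvd_five_pow_sub_one f
  have hεδ : ε = δ := by
    obtain ⟨h1, -⟩ := h
    obtain ⟨h2, -⟩ := h'
    interval_cases ε <;> interval_cases δ <;> simp at hd ⊢ <;> omega
  subst hεδ
  have h5 : (5 : ZMod (2 ^ k)) ^ e = 5 ^ f :=
    ((isUnit_one.neg.pow ε : IsUnit ((-1 : ZMod (2 ^ k)) ^ ε)).mul_right_injective heq)
  rw [← orderOf_five_zmod_two_pow hk] at h h'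
  rw [pow_injOn_Iio_orderOf h.2 h'.2 h5]

theorem existsUnique_neg_one_pow_mul_five_pow {k : ℕ} (hk : 2 ≤ k) {a : ℤ}
    (ha : ¬ ((2 : ℕ) : ℤ) ∣ a) :
    ∃! εe : ℕ × ℕ, εe.1 ∈ ({0, 1} : Set ℕ) ∧ εe.2 < 2 ^ (k - 2) ∧
      (a : ZMod (2 ^ k)) = (-1) ^ εe.1 * 5 ^ εe.2 := by
  have hmem : ∀ x : ℕ × ℕ, x.1 ∈ ({0, 1} : Set ℕ) ∧ x.2 < 2 ^ (k - 2) ↔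
      x ∈ Finset.range 2 ×ˢ Finset.range (2 ^ (k - 2)) := by
    intro x
    simp only [Set.mem_insert_iff, Set.mem_singleton_iff, Finset.mem_product, Finset.mem_range]
    omega
  have hinj := injOn_neg_one_pow_mul_five_pow hk
  have h5 : ¬ ((2 : ℕ) : ℤ) ∣ 5 := by norm_num
  -- Existence is by counting: the `2 * 2^(k-2)` distinct values are units, and there are `φ(2^k) =
  -- 2^(k-1)` units.
  have himage : (Finset.range 2 ×ˢ Finset.range (2 ^ (k - 2))).image
      (fun x : ℕ × ℕ => (-1 : ZMod (2 ^ k)) ^ x.1 * 5 ^ x.2)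
      = Finset.univ.map ⟨((↑) : (ZMod (2 ^ k))ˣ → ZMod (2 ^ k)), Units.val_injective⟩ := by
    refine Finset.eq_of_subset_of_card_le ?_ ?_
    · intro z hz
      obtain ⟨x, -, rfl⟩ := Finset.mem_image.1 hz
      have hu : IsUnit ((-1 : ZMod (2 ^ k)) ^ x.1 * 5 ^ x.2) :=
        (isUnit_one.neg.pow _).mul
          ((by simpa using isUnit_intCast_of_not_dvd 2 k h5 : IsUnit (5 : ZMod (2 ^ k))).pow _)
      exact Finset.mem_map.2 ⟨hu.unit, Finset.mem_univ _, rfl⟩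
    · rw [Finset.card_image_of_injOn hinj, Finset.card_map, Finset.card_univ,
        ZMod.card_units_eq_totient, Nat.totient_prime_pow Nat.prime_two (by omega),
        Finset.card_product, Finset.card_range, Finset.card_range, ← pow_succ']
      simp only [Nat.add_one_sub_one, mul_one]
      exact Nat.pow_le_pow_right two_pos (by omega)
  have haI : (a : ZMod (2 ^ k)) ∈ (Finset.range 2 ×ˢ Finset.range (2 ^ (k - 2))).image
      (fun x : ℕ × ℕ => (-1 : ZMod (2 ^ k)) ^ x.1 * 5 ^ x.2) := by
    rw [himage]
    exact Finset.mem_map.2 ⟨(isUnit_intCast_of_not_dvd 2 k ha).unit, Finset.mem_univ _, rfl⟩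
  obtain ⟨x, hx, hxa⟩ := Finset.mem_image.1 haI
  obtain ⟨h1, h2⟩ := (hmem x).2 hx
  refine ⟨x, ⟨h1, h2, hxa.symm⟩, ?_⟩
  rintro z ⟨h3, h4, hz⟩
  exact hinj ((hmem z).1 ⟨h3, h4⟩) hx (hz.symm.trans hxa.symm)

/-! ### The classification -/

theorem mainTheorem3 :
    -- the case of an odd prime `p`
    (∀ (p k : ℕ) [Fact p.Prime] (a b : ℤ) (ha : ¬ (p : ℤ) ∣ a), p ≠ 2 → 1 ≤ k →
      (¬ a ≡ 1 [ZMOD p] →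
        cycleMonomial (affinePerm p k a b ha) =
          X 1 ^ 1
            * X (ordCompl[p] (orderOf (a : ZMod (p ^ k)))) ^
                ((p ^ (k - (orderOf (a : ZMod (p ^ k))).factorization p) - 1)
                  / ordCompl[p] (orderOf (a : ZMod (p ^ k))))
            * ∏ s ∈ Finset.Icc 1 ((orderOf (a : ZMod (p ^ k))).factorization p),
                X (ordCompl[p] (orderOf (a : ZMod (p ^ k))) * p ^ s) ^
                  (p ^ (k - 1 - (orderOf (a : ZMod (p ^ k))).factorization p) * (p - 1)
                    / ordCompl[p] (orderOf (a : ZMod (p ^ k))))) ∧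
      (a ≡ 1 [ZMOD p] → truncVal p k (a - 1) ≤ truncVal p k b →
        cycleMonomial (affinePerm p k a b ha) =
          X 1 ^ p ^ truncVal p k (a - 1)
            * ∏ s ∈ Finset.Icc 1 (k - truncVal p k (a - 1)),
                X (p ^ s) ^ (p ^ (truncVal p k (a - 1) - 1) * (p - 1))) ∧
      (a ≡ 1 [ZMOD p] → truncVal p k b < truncVal p k (a - 1) →
        cycleMonomial (affinePerm p k a b ha) =
          X (addOrderOf (b : ZMod (p ^ k))) ^ (p ^ k / addOrderOf (b : ZMod (p ^ k))))) ∧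
    -- the case `p = 2`
    (∀ (k : ℕ) (a b : ℤ) (ha : ¬ ((2 : ℕ) : ℤ) ∣ a), 1 ≤ k →
      (k = 1 →
        cycleMonomial (affinePerm 2 k a b ha) =
          X (addOrderOf (b : ZMod (2 ^ k))) ^ (2 / addOrderOf (b : ZMod (2 ^ k)))) ∧
      (k = 2 →
        ((a : ZMod (2 ^ k)) = 1 ∨ (a : ZMod (2 ^ k)) = 3) ∧
        ((a : ZMod (2 ^ k)) = 1 →
          cycleMonomial (affinePerm 2 k a b ha) =
            X (addOrderOf (b : ZMod (2 ^ k))) ^ (4 / addOrderOf (b : ZMod (2 ^ k)))) ∧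
        ((a : ZMod (2 ^ k)) = 3 → 2 ∣ b →
          cycleMonomial (affinePerm 2 k a b ha) = X 1 ^ 2 * X 2 ^ 1) ∧
        ((a : ZMod (2 ^ k)) = 3 → ¬ 2 ∣ b →
          cycleMonomial (affinePerm 2 k a b ha) = X 2 ^ 2)) ∧
      (3 ≤ k →
        (∃! εe : ℕ × ℕ, εe.1 ∈ ({0, 1} : Set ℕ) ∧ εe.2 < 2 ^ (k - 2) ∧
          (a : ZMod (2 ^ k)) = (-1) ^ εe.1 * 5 ^ εe.2) ∧
        ∀ ε e : ℕ, ε ∈ ({0, 1} : Set ℕ) → e < 2 ^ (k - 2) →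
          (a : ZMod (2 ^ k)) = (-1) ^ ε * 5 ^ e →
          (ε = 1 → ¬ 2 ∣ b →
            cycleMonomial (affinePerm 2 k a b ha) =
              X (2 ^ (k - 1 - truncVal 2 (k - 2) e)) ^ 2 ^ (1 + truncVal 2 (k - 2) e)) ∧
          (ε = 1 → 2 ∣ b →
            cycleMonomial (affinePerm 2 k a b ha) =
              X 1 ^ 2 * X 2 ^ (2 ^ (2 + truncVal 2 (k - 3) e) - 1)
                * ∏ s ∈ Finset.Icc 2 (k - 2 - truncVal 2 (k - 3) e),
                    X (2 ^ s) ^ 2 ^ (1 + truncVal 2 (k - 3) e)) ∧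
          (ε = 0 → truncVal 2 k b < truncVal 2 k (a - 1) →
            cycleMonomial (affinePerm 2 k a b ha) =
              X (addOrderOf (b : ZMod (2 ^ k))) ^ (2 ^ k / addOrderOf (b : ZMod (2 ^ k)))) ∧
          (ε = 0 → truncVal 2 k (a - 1) ≤ truncVal 2 k b →
            cycleMonomial (affinePerm 2 k a b ha) =
              X 1 ^ 2 ^ (2 + truncVal 2 (k - 2) e)
                * ∏ s ∈ Finset.Icc 1 (k - 2 - truncVal 2 (k - 2) e),
                    X (2 ^ s) ^ 2 ^ (1 + truncVal 2 (k - 2) e)))) := by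
  refine ⟨fun p k hp a b ha hp2 hk => ⟨?_, ?_, ?_⟩, fun k a b ha hk => ⟨?_, ?_, ?_⟩⟩
  · exact cycleMonomial_affinePerm_of_not_modEq_one hp2 hk b ha
  · intro h1 h
    have hd : (p : ℤ) ∣ a - 1 := h1.symm.dvd
    exact (liftsExponent_of_odd hp2 hd).cycleMonomial_of_le ha
      (le_truncVal_iff.2 ⟨hk, by rwa [pow_one]⟩) h
  · intro h1 h
    exact (liftsExponent_of_odd hp2 h1.symm.dvd).cycleMonomial_of_lt ha h
  · rintro rfl
    exact cycleMonomial_affinePerm_of_eq_one 2 1 a b ha (intCast_zmod_two_pow_one ha)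
  · rintro rfl
    have key : ∀ c : ℤ, (a : ZMod (2 ^ 2)) = (c : ZMod (2 ^ 2)) ↔ (4 : ℤ) ∣ a - c := by
      intro c
      have := ZMod.intCast_zmod_eq_zero_iff_dvd (a - c) (2 ^ 2)
      rw [Int.cast_sub, sub_eq_zero] at this
      exact this
    have key1 : (a : ZMod (2 ^ 2)) = 1 ↔ (4 : ℤ) ∣ a - 1 := by simpa using key 1
    have key3 : (a : ZMod (2 ^ 2)) = 3 ↔ (4 : ℤ) ∣ a - 3 := key 3
    refine ⟨by rw [key1, key3]; omega, ?_, ?_, ?_⟩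
    · exact cycleMonomial_affinePerm_of_eq_one 2 2 a b ha
    · intro h3 hb
      have h4 : (4 : ℤ) ∣ a + 1 := by rw [key3] at h3; omega
      have hc : truncVal 2 2 (a ^ 2 - 1) = 2 :=
        (truncVal_le _ _ _).antisymm (le_truncVal_iff.2 ⟨le_rfl, four_dvd_sq_sub_one h4⟩)
      have := cycleMonomial_affinePerm_two_of_even le_rfl ha h4 hb
      rw [hc] at this
      simpa using this
    · intro h3 hb
      have h4 : (4 : ℤ) ∣ a + 1 := by rw [key3] at h3; omega
      have h8 : (8 : ℤ) ∣ a ^ 2 - 1 := Int.eight_dvd_sq_sub_one_of_odd (Int.not_even_iff_odd.1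
        fun he => ha (by exact_mod_cast he.two_dvd))
      have hc : truncVal 2 (2 + 1) (a ^ 2 - 1) = 3 :=
        (truncVal_le _ _ _).antisymm (le_truncVal_iff.2 ⟨le_rfl, h8⟩)
      have := cycleMonomial_affinePerm_two_of_odd le_rfl ha h4 hb
      rw [hc] at this
      simpa using this
  · intro hk3
    refine ⟨existsUnique_neg_one_pow_mul_five_pow (by omega) ha, ?_⟩
    intro ε e _ _ hae
    rw [intCast_eq_neg_one_pow_mul_five_pow_iff] at hae
    have h5 := four_dvd_five_pow_sub_one e
    have h4k : (4 : ℤ) ∣ 2 ^ k := pow_dvd_pow (2 : ℤ) (show 2 ≤ k by omega)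
    have h4a := h4k.trans hae
    -- The factor `a + 5^e` is divisible by `2^k` and `a - 5^e` is even, so the squares agree to one
    -- more binary digit.
    have hneg : ε = 1 → (4 : ℤ) ∣ a + 1 ∧ (2 : ℤ) ^ (k + 1) ∣ a ^ 2 - 1 - ((5 ^ e) ^ 2 - 1) := by
      rintro rfl
      have h4 : (4 : ℤ) ∣ a + 1 := by rw [pow_one] at h4a; omega
      refine ⟨h4, ?_⟩
      have hfac : a ^ 2 - 1 - ((5 ^ e) ^ 2 - 1) = (a - (-1) ^ 1 * 5 ^ e) * (a - 5 ^ e) := by ring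
      rw [hfac, pow_succ]
      exact mul_dvd_mul hae (by omega)
    have hpos : ε = 0 → (4 : ℤ) ∣ a - 1 ∧
        truncVal 2 k (a - 1) = 2 + truncVal 2 (k - 2) e := by
      rintro rfl
      rw [pow_zero, one_mul] at hae h4a
      refine ⟨by omega, ?_⟩
      rw [← truncVal_two_five_pow_sub_one (by omega)]
      exact truncVal_eq_of_dvd_sub (by simpa using hae)
    refine ⟨fun hε hb => ?_, fun hε hb => ?_, fun hε h => ?_, fun hε h => ?_⟩
    · obtain ⟨h4, hsq⟩ := hneg hε
      -- Truncating at `k + 1` leaves `k + 1 - 3 = k - 2` for `e`, which is `t`; for even `b`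
      -- truncating at `k` leaves `k - 3`, which is `r`.
      have hc : truncVal 2 (k + 1) (a ^ 2 - 1) = 3 + truncVal 2 (k - 2) e := by
        rw [truncVal_eq_of_dvd_sub (p := 2) hsq, truncVal_two_five_pow_sq_sub_one (by omega)]
        rfl
      have := cycleMonomial_affinePerm_two_of_odd (k := k) (by omega) ha h4 hb
      rw [this, hc]
      generalize truncVal 2 (k - 2) e = t
      have e1 : k + 2 - (3 + t) = k - 1 - t := by omega
      have e2 : 3 + t - 2 = 1 + t := by omega
      rw [e1, e2]
    · obtain ⟨h4, hsq⟩ := hneg hε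
      have hc : truncVal 2 k (a ^ 2 - 1) = 3 + truncVal 2 (k - 3) e := by
        rw [truncVal_eq_of_dvd_sub (p := 2) ((pow_dvd_pow (2 : ℤ) k.le_succ).trans hsq),
          truncVal_two_five_pow_sq_sub_one (by omega)]
      have := cycleMonomial_affinePerm_two_of_even (k := k) (by omega) ha h4 hb
      rw [this, hc]
      generalize truncVal 2 (k - 3) e = r
      have e1 : 3 + r - 1 = 2 + r := by omega
      have e2 : 3 + r - 2 = 1 + r := by omega
      have e3 : k + 1 - (3 + r) = k - 2 - r := by omega
      rw [e1, e2, e3]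
    · exact (liftsExponent_two (hpos hε).1).cycleMonomial_of_lt ha h
    · obtain ⟨h4, hc⟩ := hpos hε
      have := (liftsExponent_two h4).cycleMonomial_of_le ha (by omega) h
      rw [this, hc]
      generalize truncVal 2 (k - 2) e = t
      have e1 : 2 + t - 1 = 1 + t := by omega
      have e2 : k - (2 + t) = k - 2 - t := by omega
      rw [e1, e2]
      simp
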